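/- Let $\mathfrak A$ be a countably infinite set of letters and $\mathfrak A^*$ the free monoid of words over it. A monoid variety $\mathbb V$ is \emph{non-finitely based} if its identities have no finite basis, that is, no finite set of identities has exactly the identities of $\mathbb V$ as its consequences. A set $W\subseteq\mathfrak A^*$ is \emph{stable with respect to} $\mathbb V$ if $\mathbf v\in W$ whenever $\mathbf u\in W$ and $\mathbb V$ satisfies $\mathbf u\approx\mathbf v$. Let $\beta$ be the fully invariant congruence on $\mathfrak A^*$ of the monoid variety defined by the identities $xtx\approx xtx^2\approx x^2tx$ and $xy^2x\approx x^2y^2$; that is, $\mathbf u\,\beta\,\mathbf v$ if and only if every monoid satisfying these identities satisfies $\mathbf u\approx\mathbf v$. Let $[\mathbf w]_\beta$ denote the $\beta$-class of a word $\mathbf w$. Let $\mathbb V$ be a monoid variety that satisfies the identity \[ x\,y_1^2y_2^2\cdots y_n^2\,x\;\approx\; x\,y_1^2\,x\,y_2^2\,x\cdots x\,y_n^2\,x \] for every $n\ge 1$. Let $a,b,t\in\mathfrak A$ be distinct letters. Suppose that the sets \[ a^+bb^+ta^+=\{a^i\,b^{j}\,t\,a^k : i\ge 1,\ j\ge 2,\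 k\ge 1\} \quad\text{and}\quad [atb^2a]_\beta \] are stable with respect to $\mathbb V$. Then $\mathbb V$ is non-finitely based. -/

import Mathlib

universe u

/-- Words over a countably infinite alphabet; the letters are the natural numbers. -/
abbrev Word : Type := FreeMonoid ℕ

/-- The letter with index `i`, viewed as a word of length one. -/
abbrev letter (i : ℕ) : Word := FreeMonoid.of i

/-- The monoid `M` satisfies the identity `p ≈ q`: every substitution of elements of `M`
for letters gives `p` and `q` the same value. -/
def MonoidSatisfies (M : Type u) [Monoid M] (p q : Word) : Prop :=
  ∀ φ : Word →* M, φ p = φ q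

/-- A variety of monoids: a class of monoids closed under submonoids, homomorphic images
and arbitrary direct products (the empty product is included, so the class is nonempty;
closure under isomorphism is a special case of closure under homomorphic images). -/
structure MonoidVariety where
  /-- Membership of a monoid in the variety. -/
  Mem : ∀ (M : Type u) [Monoid M], Prop
  submonoid_mem : ∀ (M : Type u) [Monoid M], Mem M → ∀ N : Submonoid M, Mem N
  image_mem : ∀ (M N : Type u) [Monoid M] [Monoid N] (f : M →* N),
    Function.Surjective f → Mem M → Mem N
  pi_mem : ∀ (ι : Type u) (M : ι → Type u) [∀ i, Monoid (M i)],
    (∀ i, Mem (M i)) → Mem (∀ i, M i)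

namespace MonoidVariety

/-- The variety `V` satisfies the identity `p ≈ q`: all its members do. -/
def Satisfies (V : MonoidVariety.{u}) (p q : Word) : Prop :=
  ∀ (M : Type u) [Monoid M], V.Mem M → MonoidSatisfies M p q

/-- `var S`, the variety defined by a set `S` of identities. -/
def ofIdentities (S : Set (Word × Word)) : MonoidVariety.{u} where
  Mem M _ := ∀ e ∈ S, MonoidSatisfies M e.1 e.2
  submonoid_mem M _ h N e he φ := Subtype.ext (h e he (N.subtype.comp φ))
  image_mem M N _ _ f hf h e he φ := by
    choose g hg using hf
    have hφ : φ = f.comp (FreeMonoid.lift fun i => g (φ (FreeMonoid.of i))) :=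
      FreeMonoid.hom_eq fun i => by simp [hg]
    rw [hφ]
    exact congrArg f (h e he _)
  pi_mem ι M _ h e he φ := funext fun i => h i e he ((Pi.evalMonoidHom M i).comp φ)

/-- `V` is finitely based: its identities have a finite basis, that is, there is a finite set `S`
of identities such that the identities of `V` are exactly the consequences of `S` (the identities
satisfied by all monoids satisfying `S`). -/
def FinitelyBased (V : MonoidVariety.{u}) : Prop :=
  ∃ S : Set (Word × Word), S.Finite ∧
    ∀ p q : Word, V.Satisfies p q ↔ (ofIdentities.{u} S).Satisfies p q

/-- The fully invariant congruence of `V` on the free monoid: all identities of `V`. -/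
def congruence (V : MonoidVariety.{u}) : Con Word where
  r := V.Satisfies
  iseqv :=
    { refl := fun _ _ _ _ _ => rfl
      symm := fun h M _ hM φ => (h M hM φ).symm
      trans := fun h k M _ hM φ => (h M hM φ).trans (k M hM φ) }
  mul' := fun h k M _ hM φ => by rw [map_mul, map_mul, h M hM φ, k M hM φ]

/-- A set `W` of words is stable with respect to `V`: it contains `q` whenever it contains
`p` and `V` satisfies `p ≈ q`. -/
def Stable (V : MonoidVariety.{u}) (W : Set Word) : Prop :=
  ∀ p ∈ W, ∀ q : Word, V.Satisfies p q → q ∈ W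

end MonoidVariety

/-- The identities `xtx ≈ xtx²`, `xtx ≈ x²tx`, `xy²x ≈ x²y²`, with `x`, `y`, `t` the letters
`0`, `1`, `2`. -/
def betaIdentities : Set (Word × Word) :=
  {(letter 0 * letter 2 * letter 0, letter 0 * letter 2 * letter 0 ^ 2),
   (letter 0 * letter 2 * letter 0, letter 0 ^ 2 * letter 2 * letter 0),
   (letter 0 * letter 1 ^ 2 * letter 0, letter 0 ^ 2 * letter 1 ^ 2)}

/-- The congruence `β`: the fully invariant congruence of
`var {xtx ≈ xtx² ≈ x²tx, xy²x ≈ x²y²}`. -/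
def beta : Con Word := (MonoidVariety.ofIdentities.{0} betaIdentities).congruence

/-- The `β`-class of a word. -/
def betaClass (w : Word) : Set Word := {v | beta w v}

/-- The set of words `a⁺bb⁺ta⁺`. -/
def aPlusBBPlusTAPlus (a b t : Word) : Set Word :=
  {w | ∃ i j k : ℕ, 1 ≤ i ∧ 1 ≤ j ∧ 1 ≤ k ∧ w = a ^ i * b * b ^ j * t * a ^ k}

/-- `x y₁² y₂² ⋯ yₙ² x`, where `x` is the letter `0` and `yᵢ` is the letter `i`. -/
def wordU (n : ℕ) : Word :=
  letter 0 * ((List.range n).map fun i => letter (i + 1) ^ 2).prod * letter 0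

/-- `x y₁² x y₂² x ⋯ x yₙ² x`, where `x` is the letter `0` and `yᵢ` is the letter `i`. -/
def wordV (n : ℕ) : Word :=
  letter 0 * ((List.range n).map fun i => letter (i + 1) ^ 2 * letter 0).prod

/-! Suppose a finite basis exists, and take `n` at least 2 and larger than the number of letters in
either side of each of its identities. Among the words `w` with `wordU n ≈ w` in `V`, consider those
where no `0` lies between the first `1` and the first `n`. The word `wordU n` is such a word and
`wordV n` is not, so it suffices that rewriting `A φ(u) B` to `A φ(v) B`, for a basis identity `u ≈
v`, keeps the property (`gapFree_of_satisfies`).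

Stability of the first set makes identities of `V` preserve content, letters occurring once, and the
relation "all `x` before all `y`"; hence every such `w` keeps its letters `1, …, n` in increasing
blocks. Stability of the β-class makes them preserve "the first `y` precedes every `x`". These
relations suffice unless `φ(u)` contains both `1` and `n` and `A` contains neither.

In that case `φ(u)` contains all of `1, …, n`, so by pigeonhole some letter `z` of `u` has an image
containing two of them. The block order forces `z` to occur once in `u`, hence once in `v`.
Replacing `z` by `t` gives exactly the marker in the two stable sets: the first controls `0` against
`1` left of `z`, the second controls `0` against `n` right of `z`. -/

theorem toList_letter_pow (a n : ℕ) : (letter a ^ n).toList = List.replicate n a := by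
  induction n with
  | zero => rfl
  | succ n ih => rw [pow_succ', FreeMonoid.toList_mul, ih]; rfl

theorem mem_toList_map (φ : Word →* Word) (u : Word) (j : ℕ) :
    j ∈ (φ u).toList ↔ ∃ c ∈ u.toList, j ∈ (φ (letter c)).toList := by
  induction u using FreeMonoid.recOn with
  | one => simp
  | of_mul c u ih => simp [FreeMonoid.toList_mul, ih]

theorem hom_congr_of_mem {M : Type*} [Monoid M] (f g : Word →* M) (u : Word)
    (h : ∀ c ∈ u.toList, f (letter c) = g (letter c)) : f u = g u := by
  induction u using FreeMonoid.recOn with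
  | one => simp
  | of_mul c u ih =>
    rw [map_mul, map_mul, ih fun d hd => h d (by simp [hd]), h c (by simp)]

/-- Every occurrence of `x` in the list precedes all occurrences of `y`. -/
def AllBefore (x y : ℕ) (w : List ℕ) : Prop := ∀ s r, w = s ++ x :: r → y ∉ s

/-- Every occurrence of `x` in the list is preceded by an occurrence of `y`. -/
def Preceded (x y : ℕ) (w : List ℕ) : Prop := ∀ s r, w = s ++ x :: r → y ∈ s

/-- The substitution `x ↦ a`, `y ↦ b²`, erasing all other letters. -/
def squareSubst (a b x y : ℕ) : Word →* Word :=
  FreeMonoid.lift fun c => if c = x then letter a else if c = y then letter b ^ 2 else 1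

/-! ### Reduction to two letters, with `y` squared. -/

section squareSubst
variable {a b x y : ℕ}

theorem squareSubst_fst : squareSubst a b x y (letter x) = letter a := by simp [squareSubst]

theorem squareSubst_snd (h : x ≠ y) : squareSubst a b x y (letter y) = letter b ^ 2 := by
  simp [squareSubst, h.symm]

theorem squareSubst_other {c : ℕ} (h : c ≠ x) (h' : c ≠ y) :
    squareSubst a b x y (letter c) = 1 := by
  simp [squareSubst, h, h']

theorem squareSubst_of_snd_notMem (w : Word) (h : y ∉ w.toList) :
    ∃ i, squareSubst a b x y w = letter a ^ i := by
  induction w using FreeMonoid.recOn with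
  | one => exact ⟨0, by simp⟩
  | of_mul c w ih =>
    simp only [FreeMonoid.toList_of_mul, List.mem_cons, not_or] at h
    obtain ⟨i, hi⟩ := ih h.2
    rw [map_mul, hi]
    by_cases hc : c = x
    · subst hc
      exact ⟨i + 1, by rw [squareSubst_fst, pow_succ']⟩
    · exact ⟨i, by rw [squareSubst_other hc (Ne.symm h.1), one_mul]⟩

theorem squareSubst_of_fst_notMem (w : Word) (h : x ∉ w.toList) :
    ∃ j, squareSubst a b x y w = letter b ^ j := by
  induction w using FreeMonoid.recOn with
  | one => exact ⟨0, by simp⟩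
  | of_mul c w ih =>
    simp only [FreeMonoid.toList_of_mul, List.mem_cons, not_or] at h
    obtain ⟨i, hi⟩ := ih h.2
    rw [map_mul, hi]
    by_cases hc : c = y
    · subst hc
      exact ⟨2 + i, by rw [squareSubst_snd h.1, ← pow_add]⟩
    · exact ⟨i, by rw [squareSubst_other (Ne.symm h.1) hc, one_mul]⟩

theorem squareSubst_of_allBefore (hxy : x ≠ y) (w : Word) (h : AllBefore x y w.toList)
    (hy : y ∈ w.toList) :
    ∃ i j, squareSubst a b x y w = letter a ^ i * letter b ^ (2 + j) := by
  induction w using FreeMonoid.recOn with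
  | one => simp at hy
  | of_mul c w ih =>
    rw [FreeMonoid.toList_of_mul] at h hy
    rw [map_mul]
    by_cases hc : c = y
    · subst hc
      have hx : x ∉ w.toList := fun hx => by
        obtain ⟨s, r, hsr⟩ := List.append_of_mem hx
        exact h (c :: s) r (by rw [hsr]; rfl) (by simp)
      obtain ⟨j, hj⟩ := squareSubst_of_fst_notMem (a := a) (b := b) (y := c) w hx
      exact ⟨0, j, by rw [hj, squareSubst_snd hxy, pow_add]; simp⟩
    · have h' : AllBefore x y w.toList := fun s r hsr hs =>
        h (c :: s) r (by rw [hsr]; rfl) (List.mem_cons_of_mem _ hs)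
      obtain ⟨i, j, hij⟩ := ih h' ((List.mem_cons.1 hy).resolve_left (Ne.symm hc))
      rw [hij]
      by_cases hcx : c = x
      · subst hcx
        exact ⟨i + 1, j, by rw [squareSubst_fst, pow_succ', mul_assoc]⟩
      · exact ⟨i, j, by rw [squareSubst_other hcx hc, one_mul]⟩

theorem mem_squareSubst (w : Word) {c : ℕ} (h : c ∈ (squareSubst a b x y w).toList) :
    c = a ∨ c = b := by
  obtain ⟨d, -, hd⟩ := (mem_toList_map _ _ _).1 h
  simp only [squareSubst, FreeMonoid.lift_eval_of] at hd
  split_ifs at hd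
  · exact Or.inl (by simpa using hd)
  · exact Or.inr (by simpa [toList_letter_pow] using hd)
  · simp at hd

theorem squareSubst_of_preceded (hxy : x ≠ y) (w : Word) (h : Preceded x y w.toList)
    (hy : y ∈ w.toList) :
    ∃ r : Word, squareSubst a b x y w = letter b ^ 2 * squareSubst a b x y r := by
  induction w using FreeMonoid.recOn with
  | one => simp at hy
  | of_mul c w ih =>
    rw [FreeMonoid.toList_of_mul] at h hy
    rw [map_mul]
    by_cases hc : c = y
    · subst hc
      exact ⟨w, by rw [squareSubst_snd hxy]⟩
    · have hcx : c ≠ x := fun hcx => by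
        subst hcx
        simpa using h [] w.toList rfl
      have h' : Preceded x y w.toList := fun s r hsr => by
        have := h (c :: s) r (by rw [hsr]; rfl)
        exact (List.mem_cons.1 this).resolve_left (Ne.symm hc)
      rw [squareSubst_other hcx hc, one_mul]
      exact ih h' ((List.mem_cons.1 hy).resolve_left (Ne.symm hc))

end squareSubst

/-- In `a⁺bb⁺ta⁺` no `a` occurs between a `b` and the `t`; this is the obstruction used against an
`x` following a `y`. -/
theorem not_sublist_of_mem_aPlusBBPlusTAPlus {a b t : ℕ} (hab : a ≠ b) (hat : a ≠ t)
    {w : Word} (hw : w ∈ aPlusBBPlusTAPlus (letter a) (letter b) (letter t)) :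
    ¬ [b, a, t].Sublist w.toList := by
  obtain ⟨i, j, k, -, -, -, rfl⟩ := hw
  have hta : ¬ [a, t].Sublist (t :: List.replicate k a) := fun h => by
    rcases List.sublist_cons_iff.1 h with h | ⟨r, hr, -⟩
    · have := List.eq_of_mem_replicate (h.subset (by simp : t ∈ [a, t]))
      exact hat this.symm
    · exact hat (List.cons.inj hr).1
  have hbta : ∀ m, ¬ [a, t].Sublist (List.replicate m b ++ t :: List.replicate k a) := by
    intro m
    induction m with
    | zero => simpa using hta
    | succ m ih =>
      intro h
      rcases List.sublist_cons_iff.1 h with h | ⟨r, hr, -⟩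
      · exact ih h
      · exact hab (List.cons.inj hr).1
  have key : ¬ [b, a, t].Sublist
      (List.replicate i a ++ b :: (List.replicate j b ++ t :: List.replicate k a)) := by
    induction i with
    | zero =>
      intro h
      exact hbta (j + 1) ((List.sublist_cons_self b _).trans h)
    | succ i ih =>
      intro h
      rcases List.sublist_cons_iff.1 h with h | ⟨r, hr, -⟩
      · exact ih h
      · exact hab (List.cons.inj hr).1.symm
  intro h
  apply key
  simpa [FreeMonoid.toList_mul, toList_letter_pow] using h

theorem count_of_mem_aPlusBBPlusTAPlus {a b t : ℕ} (hat : a ≠ t) (hbt : b ≠ t)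
    {w : Word} (hw : w ∈ aPlusBBPlusTAPlus (letter a) (letter b) (letter t)) :
    w.toList.count t = 1 := by
  obtain ⟨i, j, k, -, -, -, rfl⟩ := hw
  simp [FreeMonoid.toList_mul, toList_letter_pow, List.count_replicate, hat, hbt]

/-! ### The β-class of `atb²a`. -/

/-- The transition monoid of the automaton recognizing `x⁺ty{x,y}*`. -/
inductive CutMonoid : Type
  | zero | one | x | y | xy | t | xt | ty | xty
  deriving DecidableEq

namespace CutMonoid

instance : Fintype CutMonoid where
  elems := {zero, one, x, y, xy, t, xt, ty, xty}
  complete f := by cases f <;> decide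

/-- Multiplication of `CutMonoid`. -/
protected def mul : CutMonoid → CutMonoid → CutMonoid
  | one, g => g
  | f, one => f
  | x, x => x
  | x, y => xy
  | x, xy => xy
  | x, t => xt
  | x, xt => xt
  | x, ty => xty
  | x, xty => xty
  | y, x => y
  | y, y => y
  | y, xy => y
  | xy, x => xy
  | xy, y => xy
  | xy, xy => xy
  | t, y => ty
  | ty, x => ty
  | ty, y => ty
  | ty, xy => ty
  | xt, y => xty
  | xty, x => xty
  | xty, y => xty
  | xty, xy => xty
  | _, _ => zero

instance : Monoid CutMonoid where
  mul := CutMonoid.mul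
  one := one
  mul_assoc := by
    change ∀ f g h, CutMonoid.mul (CutMonoid.mul f g) h = CutMonoid.mul f (CutMonoid.mul g h)
    decide
  one_mul := by
    change ∀ f, CutMonoid.mul one f = f
    decide
  mul_one := by
    change ∀ f, CutMonoid.mul f one = f
    decide

theorem mul_mul_self : ∀ f g : CutMonoid, f * g * f = f * g * (f * f) := by decide
theorem self_mul_mul : ∀ f g : CutMonoid, f * g * f = f * f * g * f := by decide
theorem mul_sq_mul : ∀ f g : CutMonoid, f * (g * g) * f = f * f * (g * g) := by decide

theorem mem_betaIdentities : (MonoidVariety.ofIdentities.{0} betaIdentities).Mem CutMonoid := by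
  rintro e (rfl | rfl | rfl) φ
  · simpa [pow_two] using mul_mul_self _ _
  · simpa [pow_two] using self_mul_mul _ _
  · simpa [pow_two] using mul_sq_mul _ _

theorem t_mul_pow_x (m : ℕ) : t * x ^ (m + 1) = zero := by
  have : ∀ m, x ^ (m + 1) = x := fun m => by
    induction m with
    | zero => rfl
    | succ m ih => rw [pow_succ, ih]; rfl
  rw [this]; rfl

theorem mul_zero_mul : ∀ f g : CutMonoid, f * zero * g = zero := by decide

end CutMonoid

section
variable {M : Type*} [Monoid M] {X Y T : M}

/-- After `X T Y² X` any further factor in `X`, `Y` is redundant. For `X` this is the first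
identity; for `Y`, double the last `X` and apply the third identity to `Y X² Y`, then use `Y³ = Y²`.
-/
theorem beta_absorb (h₁ : ∀ f g : M, f * g * f = f * g * f ^ 2)
    (h₃ : ∀ f g : M, f * g ^ 2 * f = f ^ 2 * g ^ 2)
    (r : List Bool) :
    X * T * Y ^ 2 * X * (r.map fun c => if c then X else Y).prod = X * T * Y ^ 2 * X := by
  have hX : X * T * Y ^ 2 * X * X = X * T * Y ^ 2 * X := by
    have := h₁ X (T * Y ^ 2)
    simp only [pow_two, mul_assoc] at this ⊢
    exact this.symm
  have hY2 : Y * Y ^ 2 = Y ^ 2 := by simpa [pow_two] using (h₁ Y 1).symm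
  have hY : X * T * Y ^ 2 * X * Y = X * T * Y ^ 2 * X := by
    calc X * T * Y ^ 2 * X * Y = X * T * Y ^ 2 * X * X * Y := by rw [hX]
      _ = X * T * Y * (Y * X ^ 2 * Y) := by simp only [pow_two, mul_assoc]
      _ = X * T * (Y * Y ^ 2) * X * X := by rw [h₃]; simp only [pow_two, mul_assoc]
      _ = X * T * Y ^ 2 * X := by rw [hY2, hX]
  induction r with
  | nil => simp
  | cons c r ih =>
    rw [List.map_cons, List.prod_cons, ← mul_assoc]
    cases c
    · simpa [hY] using ih
    · simpa [hX] using ih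

/-- Leading factors `Y` merge into `Y²`; from the first `X` on, `beta_absorb` removes the rest. -/
theorem beta_collapse (h₁ : ∀ f g : M, f * g * f = f * g * f ^ 2)
    (h₃ : ∀ f g : M, f * g ^ 2 * f = f ^ 2 * g ^ 2)
    (r : List Bool) :
    X * T * Y ^ 2 * (r.map fun c => if c then X else Y).prod * X = X * T * Y ^ 2 * X := by
  induction r with
  | nil => simp
  | cons c r ih =>
    cases c
    · have hY2 : Y ^ 2 * Y = Y ^ 2 := by simpa [pow_two, mul_assoc] using (h₁ Y 1).symm
      simp only [List.map_cons, List.prod_cons, Bool.false_eq_true, if_false, ← mul_assoc]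
      rw [mul_assoc (X * T) (Y ^ 2) Y, hY2, ih]
    · have := beta_absorb (X := X) (Y := Y) (T := T) h₁ h₃ (r ++ [true])
      simpa [mul_assoc] using this

end

theorem exists_bool_list (M : Type*) [Monoid M] (φ : Word →* M) (a b : ℕ) (w : Word)
    (h : ∀ c ∈ w.toList, c = a ∨ c = b) :
    ∃ r : List Bool, φ w =
      (r.map fun c => if c then φ (letter a) else φ (letter b)).prod := by
  induction w using FreeMonoid.recOn with
  | one => exact ⟨[], by simp⟩
  | of_mul c w ih =>
    obtain ⟨r, hr⟩ := ih fun d hd => h d (by simp [hd])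
    rcases h c (by simp) with rfl | rfl
    · exact ⟨true :: r, by simp [hr]⟩
    · exact ⟨false :: r, by simp [hr]⟩

theorem mem_betaClass (a b t i : ℕ) (w : Word) (h : ∀ c ∈ w.toList, c = a ∨ c = b) :
    letter a ^ (i + 1) * letter t * letter b ^ 2 * w * letter a ∈
      betaClass (letter a * letter t * letter b ^ 2 * letter a) := by
  intro M _ hM φ
  have h₁ : ∀ f g : M, f * g * f = f * g * f ^ 2 := fun f g => by
    simpa using hM _ (Or.inl rfl) (FreeMonoid.lift fun c => if c = 0 then f else g)
  have h₂ : ∀ f g : M, f * g * f = f ^ 2 * g * f := fun f g => by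
    simpa using hM _ (Or.inr (Or.inl rfl)) (FreeMonoid.lift fun c => if c = 0 then f else g)
  have h₃ : ∀ f g : M, f * g ^ 2 * f = f ^ 2 * g ^ 2 := fun f g => by
    simpa using hM _ (Or.inr (Or.inr rfl)) (FreeMonoid.lift fun c => if c = 0 then f else g)
  obtain ⟨r, hr⟩ := exists_bool_list M φ a b w h
  have hi : ∀ (i : ℕ) (f g : M), f ^ (i + 1) * g * f = f * g * f := fun i f g => by
    induction i with
    | zero => simp
    | succ i ih =>
      rw [pow_succ', mul_assoc f, mul_assoc f, ih, ← mul_assoc, ← mul_assoc, ← pow_two, ← h₂]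
  have := hi i (φ (letter a)) (φ (letter t) * φ (letter b) ^ 2 * φ w)
  rw [map_mul, map_mul, map_mul, map_mul, map_mul, map_mul, map_mul, map_pow, map_pow,
    ← beta_collapse h₁ h₃ r, ← hr]
  simpa only [mul_assoc] using this.symm

/-- In `CutMonoid` the product `t x` is zero, while `atb²a` takes the nonzero value `xty`. So in the
β-class `t` is never followed directly by `a`. -/
theorem betaClass_cut {a b t : ℕ} (hab : a ≠ b) (hat : a ≠ t) (hbt : b ≠ t) (p q : Word) (m : ℕ) :
    p * letter t * letter a ^ (m + 1) * q ∉
      betaClass (letter a * letter t * letter b ^ 2 * letter a) := by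
  intro h
  have := h CutMonoid CutMonoid.mem_betaIdentities (FreeMonoid.lift fun c =>
    if c = a then CutMonoid.x else if c = b then CutMonoid.y else CutMonoid.t)
  rw [mul_assoc p] at this
  simp only [map_mul, map_pow, FreeMonoid.lift_eval_of, if_true, hab.symm, hat.symm, hbt.symm,
    if_false, CutMonoid.t_mul_pow_x, CutMonoid.mul_zero_mul] at this
  exact absurd this (by decide)

namespace MonoidVariety
variable {V : MonoidVariety.{u}}

theorem Satisfies.symm {p q : Word} (h : V.Satisfies p q) : V.Satisfies q p :=
  V.congruence.symm h

theorem Satisfies.trans {p q r : Word} (h : V.Satisfies p q) (h' : V.Satisfies q r) :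
    V.Satisfies p r :=
  V.congruence.trans h h'

theorem Satisfies.mul_left {p q : Word} (h : V.Satisfies p q) (r : Word) :
    V.Satisfies (r * p) (r * q) :=
  V.congruence.mul (V.congruence.refl r) h

theorem Satisfies.mul_right {p q : Word} (h : V.Satisfies p q) (r : Word) :
    V.Satisfies (p * r) (q * r) :=
  V.congruence.mul h (V.congruence.refl r)

theorem Satisfies.map {p q : Word} (h : V.Satisfies p q) (φ : Word →* Word) :
    V.Satisfies (φ p) (φ q) := fun M _ hM ψ => h M hM (ψ.comp φ)

/-! ### What stability forces on the identities of `V`. -/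

section Stability
variable {a b t : ℕ}

theorem count_map_letter (c t : ℕ) (p : Word) :
    FreeMonoid.lift (fun d => if d = c then letter t else 1) p = letter t ^ p.toList.count c := by
  induction p using FreeMonoid.recOn with
  | one => simp
  | of_mul d p ih =>
    rw [map_mul, ih]
    by_cases hd : d = c
    · subst hd; simp [pow_succ']
    · simp [hd]

theorem notMem_of_satisfies (hat : a ≠ t) (hbt : b ≠ t)
    (h₁ : V.Stable (aPlusBBPlusTAPlus (letter a) (letter b) (letter t))) {p q : Word}
    (h : V.Satisfies p q) {c : ℕ} (hc : c ∉ p.toList) : c ∉ q.toList := by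
  -- The context already contains its only `t`, so an occurrence of `c` in `q` would create a second
  -- one.
  have h' := ((h.map (FreeMonoid.lift (fun d => if d = c then letter t else 1))).mul_left
    (letter a ^ 1 * letter b * letter b ^ 1 * letter t)).mul_right (letter a ^ 1)
  rw [count_map_letter, count_map_letter, List.count_eq_zero_of_not_mem hc] at h'
  have := count_of_mem_aPlusBBPlusTAPlus hat hbt
    (h₁ _ ⟨1, 1, 1, le_rfl, le_rfl, le_rfl, by simp⟩ _ h')
  simp [FreeMonoid.toList_mul, toList_letter_pow, hat, hbt] at this
  exact List.count_eq_zero.1 this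

theorem mem_iff_of_satisfies (hat : a ≠ t) (hbt : b ≠ t)
    (h₁ : V.Stable (aPlusBBPlusTAPlus (letter a) (letter b) (letter t))) {p q : Word}
    (h : V.Satisfies p q) (c : ℕ) : c ∈ p.toList ↔ c ∈ q.toList :=
  not_iff_not.1 ⟨notMem_of_satisfies hat hbt h₁ h, notMem_of_satisfies hat hbt h₁ h.symm⟩

theorem count_eq_one_of_satisfies (hat : a ≠ t) (hbt : b ≠ t)
    (h₁ : V.Stable (aPlusBBPlusTAPlus (letter a) (letter b) (letter t))) {p q : Word}
    (h : V.Satisfies p q) {c : ℕ} (hc : p.toList.count c = 1) : q.toList.count c = 1 := by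
  -- Here the context has no `t`: the image of `c` must supply it exactly once.
  have h' := ((h.map (FreeMonoid.lift (fun d => if d = c then letter t else 1))).mul_left
    (letter a ^ 1 * letter b * letter b ^ 1)).mul_right (letter a ^ 1)
  rw [count_map_letter, count_map_letter, hc] at h'
  have := count_of_mem_aPlusBBPlusTAPlus hat hbt
    (h₁ _ ⟨1, 1, 1, le_rfl, le_rfl, le_rfl, by simp⟩ _ h')
  simpa [FreeMonoid.toList_mul, toList_letter_pow, List.count_cons, hat, hbt] using this

/-- With the context `a · a`, the left side becomes `a⁺b²b*ta⁺`. A `y` before an `x` in `q₁` would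
produce the forbidden subsequence `b, a, t` on the right side. -/
theorem allBefore_of_satisfies_squareSubst (hab : a ≠ b) (hat : a ≠ t)
    (h₁ : V.Stable (aPlusBBPlusTAPlus (letter a) (letter b) (letter t)))
    {x y : ℕ} (hxy : x ≠ y) {p₁ p₂ q₁ q₂ : Word}
    (h : V.Satisfies (squareSubst a b x y p₁ * letter t * squareSubst a b x y p₂)
      (squareSubst a b x y q₁ * letter t * squareSubst a b x y q₂))
    (hp : AllBefore x y p₁.toList) (hy : y ∈ p₁.toList) (hy₂ : y ∉ p₂.toList) :
    AllBefore x y q₁.toList := by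
  intro s r hsr hys
  obtain ⟨i, j, hij⟩ := squareSubst_of_allBefore (a := a) (b := b) hxy p₁ hp hy
  obtain ⟨k, hk⟩ := squareSubst_of_snd_notMem (a := a) (b := b) (x := x) p₂ hy₂
  have h' := (h.mul_left (letter a)).mul_right (letter a)
  refine not_sublist_of_mem_aPlusBBPlusTAPlus hab hat
    (h₁ _ ⟨i + 1, j + 1, k + 1, by omega, by omega, by omega, ?_⟩ _ h') ?_
  · rw [hij, hk]
    simp only [pow_succ', pow_add, mul_assoc, pow_zero, one_mul, ← pow_succ]
  · have hq : q₁ = FreeMonoid.ofList s * letter x * FreeMonoid.ofList r := by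
      apply FreeMonoid.toList.injective
      simp [hsr, FreeMonoid.toList_mul]
    have hb : [b].Sublist (squareSubst a b x y (FreeMonoid.ofList s)).toList := by
      rw [List.singleton_sublist, mem_toList_map]
      exact ⟨y, by simpa using hys, by simp [squareSubst_snd hxy, toList_letter_pow]⟩
    rw [hq, map_mul (squareSubst a b x y) _ (FreeMonoid.ofList r),
      map_mul (squareSubst a b x y) _ (letter x), squareSubst_fst]
    simp only [FreeMonoid.toList_mul, FreeMonoid.toList_of, List.append_assoc]
    refine List.Sublist.trans ?_ (List.sublist_append_right _ _)
    refine List.Sublist.append (l₁ := [b]) hb ?_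
    refine List.Sublist.append (l₁ := [a]) (List.Sublist.refl _) ?_
    exact List.Sublist.trans (by simp) (List.sublist_append_right _ _)

/-- With the context `a · a`, the left side becomes `a⁺tb²⋯a`, which is β-equivalent to `atb²a`. If
some `x` in `q₂` had no `y` before it, then `t` would be followed directly by `a` on the right side,
contrary to `betaClass_cut`. -/
theorem preceded_of_satisfies_squareSubst (hab : a ≠ b) (hat : a ≠ t) (hbt : b ≠ t)
    (h₂ : V.Stable (betaClass (letter a * letter t * letter b ^ 2 * letter a)))
    {x y : ℕ} (hxy : x ≠ y) {p₁ p₂ q₁ q₂ : Word}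
    (h : V.Satisfies (squareSubst a b x y p₁ * letter t * squareSubst a b x y p₂)
      (squareSubst a b x y q₁ * letter t * squareSubst a b x y q₂))
    (hp : Preceded x y p₂.toList) (hy : y ∈ p₂.toList) (hy₁ : y ∉ p₁.toList) :
    Preceded x y q₂.toList := by
  intro s r hsr
  by_contra hys
  obtain ⟨r', hr'⟩ := squareSubst_of_preceded (a := a) (b := b) hxy p₂ hp hy
  obtain ⟨i, hi⟩ := squareSubst_of_snd_notMem (a := a) (b := b) (x := x) p₁ hy₁
  obtain ⟨m, hm⟩ := squareSubst_of_snd_notMem (a := a) (b := b) (x := x) (FreeMonoid.ofList s) hys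
  have h' := (h.mul_left (letter a)).mul_right (letter a)
  have hq : q₂ = FreeMonoid.ofList s * letter x * FreeMonoid.ofList r := by
    apply FreeMonoid.toList.injective
    simp [hsr, FreeMonoid.toList_mul]
  have hmem := mem_betaClass a b t i (squareSubst a b x y r') fun c => mem_squareSubst r'
  have e : letter a * (squareSubst a b x y p₁ * letter t * squareSubst a b x y p₂) * letter a =
      letter a ^ (i + 1) * letter t * letter b ^ 2 * squareSubst a b x y r' * letter a := by
    rw [hi, hr']
    simp only [pow_succ', mul_assoc]
  rw [e] at h'
  have := h₂ _ hmem _ h'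
  rw [hq, map_mul, map_mul, squareSubst_fst, hm] at this
  refine betaClass_cut hab hat hbt (letter a * squareSubst a b x y q₁)
    (squareSubst a b x y (FreeMonoid.ofList r) * letter a) m ?_
  rw [pow_succ _ m]
  simpa only [mul_assoc] using this

end Stability
end MonoidVariety

namespace MonoidVariety
variable {V : MonoidVariety.{u}} {a b t : ℕ}

theorem allBefore_of_satisfies (hab : a ≠ b) (hat : a ≠ t) (hbt : b ≠ t)
    (h₁ : V.Stable (aPlusBBPlusTAPlus (letter a) (letter b) (letter t)))
    {x y : ℕ} (hxy : x ≠ y) {p q : Word} (h : V.Satisfies p q)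
    (hp : AllBefore x y p.toList) : AllBefore x y q.toList := by
  by_cases hy : y ∈ p.toList
  -- No letter need be cut here: `t` is appended after the whole word.
  · refine allBefore_of_satisfies_squareSubst (p₂ := 1) (q₂ := 1) hab hat h₁ hxy ?_ hp hy
      (by simp)
    exact ((h.map _).mul_right _).mul_right _
  · have hq := notMem_of_satisfies hat hbt h₁ h hy
    exact fun s r hsr hs => hq (by rw [hsr]; exact List.mem_append_left _ hs)

theorem preceded_of_satisfies (hab : a ≠ b) (hat : a ≠ t) (hbt : b ≠ t)
    (h₁ : V.Stable (aPlusBBPlusTAPlus (letter a) (letter b) (letter t)))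
    (h₂ : V.Stable (betaClass (letter a * letter t * letter b ^ 2 * letter a)))
    {x y : ℕ} (hxy : x ≠ y) {p q : Word} (h : V.Satisfies p q)
    (hp : Preceded x y p.toList) : Preceded x y q.toList := by
  by_cases hy : y ∈ p.toList
  · refine preceded_of_satisfies_squareSubst (p₁ := 1) (q₁ := 1) hab hat hbt h₂ hxy ?_ hp hy
      (by simp)
    simpa [mul_assoc] using (h.map (squareSubst a b x y)).mul_left (letter t)
  · have hx : x ∉ p.toList := fun hx => by
      obtain ⟨s, r, hsr⟩ := List.append_of_mem hx
      exact hy (by rw [hsr]; exact List.mem_append_left _ (hp s r hsr))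
    have hq := notMem_of_satisfies hat hbt h₁ h hx
    exact fun s r hsr => (hq (by rw [hsr]; simp)).elim

/-- Substituting according to `φ` away from a letter `z` that occurs once on both sides, and
marking that letter by `t`. -/
theorem Satisfies.map_cut {z : ℕ} {u₁ u₂ v₁ v₂ : Word}
    (h : V.Satisfies (u₁ * letter z * u₂) (v₁ * letter z * v₂))
    (hu₁ : z ∉ u₁.toList) (hu₂ : z ∉ u₂.toList) (hv₁ : z ∉ v₁.toList) (hv₂ : z ∉ v₂.toList)
    (φ : Word →* Word) (t : ℕ) :
    V.Satisfies (φ u₁ * letter t * φ u₂) (φ v₁ * letter t * φ v₂) := by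
  have key : ∀ w : Word, z ∉ w.toList →
      FreeMonoid.lift (fun c => if c = z then letter t else φ (letter c)) w = φ w := by
    intro w hw
    refine hom_congr_of_mem _ _ w fun c hc => ?_
    have : c ≠ z := fun e => hw (e ▸ hc)
    simp [this]
  have h' := h.map (FreeMonoid.lift fun c => if c = z then letter t else φ (letter c))
  simpa [map_mul, key, hu₁, hu₂, hv₁, hv₂] using h'

end MonoidVariety

/-! ### The invariant and its preservation under one rewriting. -/

/-- The letters `1, …, n` occur in the word, in increasing order. -/
def BlockOrdered (n : ℕ) (w : List ℕ) : Prop :=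
  (∀ i, 1 ≤ i → i ≤ n → i ∈ w) ∧ ∀ i j, 1 ≤ i → i < j → j ≤ n → AllBefore i j w

/-- No occurrence of the letter `0` lies between the first occurrences of `1` and `n`. -/
def GapFree (n : ℕ) (w : List ℕ) : Prop := ∀ s r, w = s ++ 0 :: r → 1 ∈ s → n ∈ s

theorem exists_cut_of_count_eq_one {z : ℕ} {u : Word} (h : u.toList.count z = 1) :
    ∃ u₁ u₂ : Word, u = u₁ * letter z * u₂ ∧ z ∉ u₁.toList ∧ z ∉ u₂.toList := by
  have hz : z ∈ u.toList := List.count_pos_iff.1 (by omega)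
  obtain ⟨s, r, hsr⟩ := List.append_of_mem hz
  rw [hsr, List.count_append, List.count_cons_self] at h
  refine ⟨FreeMonoid.ofList s, FreeMonoid.ofList r, ?_, List.count_eq_zero.1 ?_,
    List.count_eq_zero.1 ?_⟩
  · apply FreeMonoid.toList.injective
    simp [hsr, FreeMonoid.toList_mul]
  · simp only [FreeMonoid.toList_ofList]; omega
  · simp only [FreeMonoid.toList_ofList]; omega

theorem BlockOrdered.notMem_left {n i j : ℕ} {p q : List ℕ} (h : BlockOrdered n (p ++ q))
    (hi : 1 ≤ i) (hij : i < j) (hj : j ≤ n) (hq : i ∈ q) : j ∉ p := by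
  obtain ⟨s, r, rfl⟩ := List.append_of_mem hq
  intro hp
  exact h.2 i j hi hij hj (p ++ s) r (by simp) (List.mem_append_left _ hp)

/-- A word mapped to a factor that contains `1` and `n`, but has fewer than `n` letters, has a letter
with a single occurrence whose image contains two of the letters `1, …, n`. -/
theorem BlockOrdered.exists_cut {n : ℕ} {u : Word} (hn : u.toList.toFinset.card < n)
    (φ : Word →* Word) {A B : List ℕ} (h : BlockOrdered n (A ++ (φ u).toList ++ B))
    (hA : n ∈ (φ u).toList) (h1 : 1 ∈ (φ u).toList) :
    ∃ z i j, 1 ≤ i ∧ i < j ∧ j ≤ n ∧ i ∈ (φ (letter z)).toList ∧ j ∈ (φ (letter z)).toList ∧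
      u.toList.count z = 1 := by
  have hmem : ∀ i ∈ Finset.Icc 1 n, i ∈ (φ u).toList := by
    intro i hi
    rw [Finset.mem_Icc] at hi
    rcases hi.1.eq_or_lt with rfl | hi1
    · exact h1
    rcases hi.2.eq_or_lt with rfl | hin
    · exact hA
    have hi' := h.1 i hi.1 hi.2
    rw [List.mem_append, List.mem_append] at hi'
    rcases hi' with (hi' | hi') | hi'
    · rw [List.append_assoc] at h
      exact (h.notMem_left le_rfl hi1 hi.2 (List.mem_append_left _ h1) hi').elim
    · exact hi'
    · exact (h.notMem_left hi.1 hin le_rfl hi' (List.mem_append_right _ hA)).elim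
  have hc : ∀ i ∈ Finset.Icc 1 n, ∃ c ∈ u.toList, i ∈ (φ (letter c)).toList :=
    fun i hi => (mem_toList_map φ u i).1 (hmem i hi)
  choose! f hf hf' using hc
  -- Pigeonhole: `n` numbers are assigned to fewer than `n` letters of `u`.
  obtain ⟨i, hi, j, hj, hij, hfij⟩ := Finset.exists_ne_map_eq_of_card_lt_of_maps_to
    (s := Finset.Icc 1 n) (t := u.toList.toFinset) (f := f) (by simpa using hn)
    (fun i hi => by simpa using hf i hi)
  wlog hlt : i < j generalizing i j
  · exact this j hj i hi hij.symm hfij.symm (by omega)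
  have hjz := hf' j hj
  rw [← hfij] at hjz
  have hiz := hf' i hi
  rw [Finset.mem_Icc] at hi hj
  refine ⟨f i, i, j, hi.1, hlt, hj.2, hiz, hjz, ?_⟩
  obtain ⟨s, r, hsr⟩ := List.append_of_mem (hf i (Finset.mem_Icc.2 hi))
  have hu : u = FreeMonoid.ofList s * letter (f i) * FreeMonoid.ofList r := by
    apply FreeMonoid.toList.injective
    simp [hsr, FreeMonoid.toList_mul]
  have e : φ u = φ (FreeMonoid.ofList s) * φ (letter (f i)) * φ (FreeMonoid.ofList r) := by
    conv_lhs => rw [hu]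
    rw [map_mul, map_mul]
  rw [e, FreeMonoid.toList_mul, FreeMonoid.toList_mul] at h
  -- A second occurrence of this letter, on either side, would put a `j` before an `i`.
  have hs : f i ∉ s := fun hs => by
    have : j ∈ (φ (FreeMonoid.ofList s)).toList := (mem_toList_map _ _ _).2 ⟨f i, hs, hjz⟩
    refine BlockOrdered.notMem_left (p := A ++ (φ (FreeMonoid.ofList s)).toList)
      (q := (φ (letter (f i))).toList ++ ((φ (FreeMonoid.ofList r)).toList ++ B))
      (by simpa using h) hi.1 hlt hj.2 (List.mem_append_left _ hiz) (List.mem_append_right _ this)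
  have hr : f i ∉ r := fun hr => by
    have : i ∈ (φ (FreeMonoid.ofList r)).toList := (mem_toList_map _ _ _).2 ⟨f i, hr, hiz⟩
    refine BlockOrdered.notMem_left
      (p := A ++ (φ (FreeMonoid.ofList s)).toList ++ (φ (letter (f i))).toList)
      (q := (φ (FreeMonoid.ofList r)).toList ++ B)
      (by simpa using h) hi.1 hlt hj.2 (List.mem_append_left _ this) (List.mem_append_right _ hjz)
  rw [hsr, List.count_append, List.count_cons_self, List.count_eq_zero.2 hs,
    List.count_eq_zero.2 hr]

theorem append_eq_append_cons {A L s r : List ℕ} {x : ℕ} (h : A ++ L = s ++ x :: r) :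
    (∃ r', A = s ++ x :: r' ∧ r = r' ++ L) ∨ ∃ s', s = A ++ s' ∧ L = s' ++ x :: r := by
  rcases List.append_eq_append_iff.1 h with ⟨s', rfl, hL⟩ | ⟨c, rfl, hc⟩
  · exact Or.inr ⟨s', rfl, hL⟩
  · cases c with
    | nil => exact Or.inr ⟨[], by simp, by simpa using hc.symm⟩
    | cons d c =>
      simp only [List.cons_append, List.cons.injEq] at hc
      obtain ⟨rfl, rfl⟩ := hc
      exact Or.inl ⟨c, rfl, rfl⟩

namespace MonoidVariety
variable {V : MonoidVariety.{u}} {a b t : ℕ}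

/-- An offending `0` lies before, inside or after the image of `z`. Before it, `n` has not yet
occurred on the `u` side, so there `0` precedes `1` and the first stable set applies. Inside it, the
`0` and what precedes it in `φ(z)` are the same on both sides. After it, `1` has already occurred on
the `u` side, so `n` must precede `0` and the second stable set applies. -/
theorem gapFree_of_satisfies_of_cut (hab : a ≠ b) (hat : a ≠ t) (hbt : b ≠ t)
    (h₁ : V.Stable (aPlusBBPlusTAPlus (letter a) (letter b) (letter t)))
    (h₂ : V.Stable (betaClass (letter a * letter t * letter b ^ 2 * letter a)))
    {n : ℕ} {z : ℕ} {u₁ u₂ v₁ v₂ : Word}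
    (h : V.Satisfies (u₁ * letter z * u₂) (v₁ * letter z * v₂))
    (hu₁ : z ∉ u₁.toList) (hu₂ : z ∉ u₂.toList) (hv₁ : z ∉ v₁.toList) (hv₂ : z ∉ v₂.toList)
    (φ : Word →* Word) {A : List ℕ}
    (hA1 : 1 ∉ A) (hAn : n ∉ A) (h1u₂ : 1 ∉ (φ u₂).toList) (hnu₁ : n ∉ (φ u₁).toList)
    (h1 : 1 ∈ (φ u₁).toList ++ (φ (letter z)).toList)
    (hn : n ∈ (φ (letter z)).toList ++ (φ u₂).toList) (hn0 : n ≠ 0)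
    (hP : GapFree n (A ++ ((φ u₁).toList ++ ((φ (letter z)).toList ++ (φ u₂).toList)))) :
    GapFree n (A ++ ((φ v₁).toList ++ ((φ (letter z)).toList ++ (φ v₂).toList))) := by
  have hcut := h.map_cut hu₁ hu₂ hv₁ hv₂
  have hv1 : 1 ∉ (φ u₁).toList → 1 ∉ (φ v₁).toList := by
    intro h1u₁ hv
    obtain ⟨c, hc, hc1⟩ := (mem_toList_map _ _ _).1 hv
    have hcz : c ≠ z := fun e => hv₁ (e ▸ hc)
    have hcu := (mem_iff_of_satisfies hat hbt h₁ h c).2 (by simp [FreeMonoid.toList_mul, hc])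
    simp only [FreeMonoid.toList_mul, FreeMonoid.toList_of, List.mem_append, List.mem_singleton,
      hcz, or_false] at hcu
    rcases hcu with hcu | hcu
    · exact h1u₁ ((mem_toList_map _ _ _).2 ⟨c, hcu, hc1⟩)
    · exact h1u₂ ((mem_toList_map _ _ _).2 ⟨c, hcu, hc1⟩)
  intro s r hsr hs
  replace hsr := append_eq_append_cons hsr
  rcases hsr with ⟨r', rfl, -⟩ | ⟨s, rfl, hsr⟩
  · exact (hA1 (List.mem_append_left _ hs)).elim
  replace hs : 1 ∈ s := (List.mem_append.1 hs).resolve_left hA1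
  replace hsr := append_eq_append_cons hsr
  rcases hsr with ⟨r', hr', -⟩ | ⟨s, rfl, hsr⟩
  · exfalso
    have h1u₁ : 1 ∈ (φ u₁).toList := by
      by_contra h1u₁
      exact hv1 h1u₁ (by rw [hr']; exact List.mem_append_left _ hs)
    refine allBefore_of_satisfies_squareSubst hab hat h₁ (x := 0) (y := 1) (by simp)
      (hcut ((squareSubst a b 0 1).comp φ) t) ?_ h1u₁ h1u₂ s r' hr' hs
    intro s' r' hsr' hs'
    have := hP (A ++ s') (r' ++ ((φ (letter z)).toList ++ (φ u₂).toList)) (by simp [hsr'])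
      (List.mem_append_right _ hs')
    rcases List.mem_append.1 this with this | this
    · exact hAn this
    · exact hnu₁ (by rw [hsr']; exact List.mem_append_left _ this)
  replace hsr := append_eq_append_cons hsr
  rcases hsr with ⟨r', hr', -⟩ | ⟨s, rfl, hsr⟩
  · by_cases h1s : 1 ∈ (φ u₁).toList ++ s
    · have := hP (A ++ ((φ u₁).toList ++ s)) (r' ++ (φ u₂).toList) (by simp [hr'])
        (List.mem_append_right _ h1s)
      simp only [List.mem_append, hAn, hnu₁, false_or] at this
      simp [this]
    · simp only [List.mem_append, not_or] at h1s hs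
      exact (hs.elim (hv1 h1s.1) h1s.2).elim
  · by_cases hnz : n ∈ (φ (letter z)).toList
    · simp [hnz]
    have hnu₂ : n ∈ (φ u₂).toList := (List.mem_append.1 hn).resolve_left hnz
    have := preceded_of_satisfies_squareSubst hab hat hbt h₂ (x := 0) (y := n) hn0.symm
      (hcut ((squareSubst a b 0 n).comp φ) t) ?_ hnu₂ hnu₁ s r hsr
    · simp [this]
    intro s' r' hsr'
    have := hP (A ++ ((φ u₁).toList ++ ((φ (letter z)).toList ++ s'))) r' (by simp [hsr']) (by
      rw [← List.append_assoc (φ u₁).toList]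
      exact List.mem_append_right _ (List.mem_append_left _ h1))
    simpa only [List.mem_append, hAn, hnu₁, hnz, false_or] using this

theorem gapFree_of_satisfies (hab : a ≠ b) (hat : a ≠ t) (hbt : b ≠ t)
    (h₁ : V.Stable (aPlusBBPlusTAPlus (letter a) (letter b) (letter t)))
    (h₂ : V.Stable (betaClass (letter a * letter t * letter b ^ 2 * letter a)))
    {n : ℕ} {u v : Word} (h : V.Satisfies u v) (hcard : u.toList.toFinset.card < n)
    (φ : Word →* Word) {A B : List ℕ} (hO : BlockOrdered n (A ++ (φ u).toList ++ B))
    (hP : GapFree n (A ++ (φ u).toList ++ B)) : GapFree n (A ++ (φ v).toList ++ B) := by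
  have hφ := h.map φ
  have hmem := mem_iff_of_satisfies hat hbt h₁ hφ
  have hn0 : n ≠ 0 := by omega
  intro s r hsr hs
  replace hsr := append_eq_append_cons hsr
  rcases hsr with ⟨r, hsr, -⟩ | ⟨s, rfl, hsr⟩
  swap
  · have := hP (A ++ (φ u).toList ++ s) r (by simp [hsr]) (by
      simpa only [List.mem_append, hmem] using hs)
    simpa only [List.mem_append, hmem] using this
  replace hsr := append_eq_append_cons hsr
  rcases hsr with ⟨r, hsr, -⟩ | ⟨s, rfl, hsr⟩
  · exact hP s (r ++ (φ u).toList ++ B) (by simp [hsr]) hs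
  by_cases hAn : n ∈ A
  · exact List.mem_append_left _ hAn
  have hP' : GapFree n (A ++ (φ u).toList) := fun s r hsr hs =>
    hP s (r ++ B) (by simp [hsr]) hs
  -- If `1` is already in `A` and `n` is not, then inside `φ u` every `0` must come after an `n`.
  by_cases hA1 : 1 ∈ A
  · refine List.mem_append_right _ (preceded_of_satisfies hab hat hbt h₁ h₂ hn0.symm hφ ?_ s r hsr)
    intro s r hsr
    exact (List.mem_append.1 (hP' (A ++ s) r (by simp [hsr])
      (List.mem_append_left _ hA1))).resolve_left hAn
  replace hs : 1 ∈ s := (List.mem_append.1 hs).resolve_left hA1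
  have hu1 : 1 ∈ (φ u).toList := (hmem 1).2 (by rw [hsr]; exact List.mem_append_left _ hs)
  by_cases hun : n ∈ (φ u).toList
  swap
  · refine (allBefore_of_satisfies hab hat hbt h₁ (x := 0) (y := 1) (by simp) hφ ?_ s r hsr hs).elim
    intro s r hsr hs
    have := (List.mem_append.1 (hP' (A ++ s) r (by simp [hsr])
      (List.mem_append_right _ hs))).resolve_left hAn
    exact hun (by rw [hsr]; exact List.mem_append_left _ this)
  obtain ⟨z, i, j, hi, hij, hj, hiz, hjz, hz⟩ := hO.exists_cut hcard φ hun hu1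
  obtain ⟨u₁, u₂, rfl, hu₁, hu₂⟩ := exists_cut_of_count_eq_one hz
  obtain ⟨v₁, v₂, rfl, hv₁, hv₂⟩ := exists_cut_of_count_eq_one
    (count_eq_one_of_satisfies hat hbt h₁ h hz)
  simp only [map_mul, FreeMonoid.toList_mul, List.append_assoc] at hO hP' hun hu1 hsr
  have h1u₂ : 1 ∉ (φ u₂).toList := fun h1 => by
    refine BlockOrdered.notMem_left (p := A ++ (φ u₁).toList ++ (φ (letter z)).toList)
      (q := (φ u₂).toList ++ B) (by simpa using hO) le_rfl (hi.trans_lt hij) hj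
      (List.mem_append_left _ h1) (List.mem_append_right _ hjz)
  have hnu₁ : n ∉ (φ u₁).toList := fun hn => by
    refine BlockOrdered.notMem_left (p := A ++ (φ u₁).toList)
      (q := (φ (letter z)).toList ++ ((φ u₂).toList ++ B)) (by simpa using hO) hi
      (hij.trans_le hj) le_rfl (List.mem_append_left _ hiz) (List.mem_append_right _ hn)
  refine gapFree_of_satisfies_of_cut hab hat hbt h₁ h₂ h hu₁ hu₂ hv₁ hv₂ φ hA1 hAn h1u₂ hnu₁
    ?_ ((List.mem_append.1 hun).resolve_left hnu₁) hn0 hP' (A ++ s) r (by simp [hsr])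
    (List.mem_append_right _ hs)
  simpa only [List.mem_append, h1u₂, or_false] using hu1

end MonoidVariety

/-! ### The invariant on the two words. -/

theorem toList_wordU (n : ℕ) :
    (wordU n).toList = 0 :: ((List.range n).flatMap fun i => [i + 1, i + 1]) ++ [0] := by
  simp [wordU, FreeMonoid.toList_mul, FreeMonoid.toList_prod, List.flatMap, toList_letter_pow,
    Function.comp_def]

theorem toList_wordV (n : ℕ) :
    (wordV n).toList = 0 :: ((List.range n).flatMap fun i => [i + 1, i + 1, 0]) := by
  simp [wordV, FreeMonoid.toList_mul, FreeMonoid.toList_prod, List.flatMap, toList_letter_pow,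
    Function.comp_def]

theorem gapFree_wordU {n : ℕ} (hn : 1 ≤ n) : GapFree n (wordU n).toList := by
  intro s r hsr hs
  rw [toList_wordU] at hsr
  rcases append_eq_append_cons hsr with ⟨r', hr', -⟩ | ⟨s', rfl, -⟩
  · cases s with
    | nil => simp at hs
    | cons c s =>
      simp only [List.cons_append, List.cons.injEq] at hr'
      have : 0 ∈ (List.range n).flatMap fun i => [i + 1, i + 1] := by rw [hr'.2]; simp
      simp at this
  · have : n ∈ (List.range n).flatMap fun i => [i + 1, i + 1] := by
      simp only [List.mem_flatMap, List.mem_range]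
      exact ⟨n - 1, by omega, by simp; omega⟩
    simp only [List.cons_append, List.mem_cons, List.mem_append, this, true_or, or_true]

theorem not_gapFree_wordV {n : ℕ} (hn : 2 ≤ n) : ¬ GapFree n (wordV n).toList := by
  obtain ⟨m, rfl⟩ := Nat.exists_eq_add_of_le' hn
  intro h
  -- The second `0` of `wordV` comes after `0, 1, 1`, which does not contain `n ≥ 2`.
  have := h [0, 1, 1] (((List.range (m + 1)).map Nat.succ).flatMap fun i => [i + 1, i + 1, 0]) (by
    rw [toList_wordV, List.range_succ_eq_map]; rfl) (by simp)
  simp at this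

theorem blockOrdered_wordU (n : ℕ) : BlockOrdered n (wordU n).toList := by
  rw [toList_wordU]
  constructor
  · intro i hi hin
    simp only [List.cons_append, List.mem_cons, List.mem_append, List.mem_flatMap, List.mem_range]
    exact Or.inr (Or.inl ⟨i - 1, by omega, by simp; omega⟩)
  · intro i j hi hij hj s r hsr hs
    have hpair : ((List.range n).flatMap fun i => [i + 1, i + 1]).Pairwise (· ≤ ·) := by
      rw [List.pairwise_flatMap]
      refine ⟨fun i _ => by simp, List.pairwise_lt_range.imp fun h => ?_⟩
      simp only [List.mem_cons, List.not_mem_nil, or_false, or_self]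
      rintro _ rfl _ rfl
      omega
    -- With the zeros deleted, `wordU` is a nondecreasing list, so no `j > i` precedes an `i`.
    have hf := congrArg (List.filter (· ≠ 0)) hsr
    have hi0 : i ≠ 0 := by omega
    have hM : ((List.range n).flatMap fun i => [i + 1, i + 1]).filter (· ≠ 0) =
        (List.range n).flatMap fun i => [i + 1, i + 1] := by
      simp only [List.filter_eq_self, List.mem_flatMap, List.mem_cons, List.not_mem_nil, or_false,
        or_self]
      rintro _ ⟨k, -, rfl⟩
      simp
    rw [List.cons_append, List.filter_cons_of_neg (by simp), List.filter_append, hM,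
      List.filter_append, List.filter_cons_of_pos (p := (· ≠ 0)) (a := i) (by simpa using hi0),
      show [0].filter (fun x : ℕ => decide (x ≠ 0)) = [] by simp, List.append_nil] at hf
    rw [hf, List.pairwise_append] at hpair
    have := hpair.2.2 j (by simp [hs]; omega) i (by simp)
    omega

namespace MonoidVariety
variable {V : MonoidVariety.{u}} {a b t : ℕ}

theorem blockOrdered_of_satisfies (hab : a ≠ b) (hat : a ≠ t) (hbt : b ≠ t)
    (h₁ : V.Stable (aPlusBBPlusTAPlus (letter a) (letter b) (letter t)))
    {n : ℕ} {p q : Word} (h : V.Satisfies p q) (hp : BlockOrdered n p.toList) :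
    BlockOrdered n q.toList :=
  ⟨fun i hi hin => (mem_iff_of_satisfies hat hbt h₁ h i).1 (hp.1 i hi hin),
    fun i j hi hij hj => allBefore_of_satisfies hab hat hbt h₁ hij.ne h (hp.2 i j hi hij hj)⟩

end MonoidVariety

/-! ### Equational deduction and the conclusion. -/

/-- The syntactic congruence of a set of words. -/
def syntacticCon (L : Set Word) : Con Word where
  r p q := ∀ A B, A * p * B ∈ L ↔ A * q * B ∈ L
  iseqv := ⟨fun _ _ _ => Iff.rfl, fun h A B => (h A B).symm,
    fun h k A B => (h A B).trans (k A B)⟩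
  mul' := fun {w x y z} h k A B => by
    have h' := h A (y * B)
    have k' := k (A * x) B
    simp only [mul_assoc] at h' k' ⊢
    exact h'.trans k'

/-- If the substitution instances of the identities in `S` preserve `L` in every context, then so do
the consequences of `S`. -/
theorem mem_iff_mem_of_ofIdentities {S : Set (Word × Word)} {L : Set Word}
    (hL : ∀ e ∈ S, ∀ (φ : Word →* Word) (A B : Word), A * φ e.1 * B ∈ L ↔ A * φ e.2 * B ∈ L)
    {p q : Word} (h : (MonoidVariety.ofIdentities.{u} S).Satisfies p q) : p ∈ L ↔ q ∈ L := by
  let c := syntacticCon L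
  -- Any substitution into the syntactic monoid lifts to a substitution of words, so the hypothesis
  -- on `L` says that this monoid satisfies `S`.
  have hM : (MonoidVariety.ofIdentities.{u} S).Mem (ULift.{u} c.Quotient) := by
    intro e he φ
    choose g hg using fun i => Con.mk'_surjective (c := c) (φ (letter i)).down
    have hφ : ∀ w, (φ w).down = c.mk' (FreeMonoid.lift g w) := by
      intro w
      have : (MulEquiv.ulift.toMonoidHom.comp φ : Word →* c.Quotient) =
          c.mk'.comp (FreeMonoid.lift g) := FreeMonoid.hom_eq fun i => (hg i).symm
      exact DFunLike.congr_fun this w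
    apply ULift.down_injective
    rw [hφ, hφ]
    exact (Con.eq c).2 fun A B => hL e he _ A B
  have := h _ hM (MulEquiv.ulift.symm.toMonoidHom.comp c.mk')
  have := (Con.eq c).1 (congrArg ULift.down this)
  simpa using this 1 1

theorem mainTheorem2 (V : MonoidVariety.{u})
    (hV : ∀ n : ℕ, 1 ≤ n → V.Satisfies (wordU n) (wordV n))
    (a b t : ℕ) (hab : a ≠ b) (hat : a ≠ t) (hbt : b ≠ t)
    (h₁ : V.Stable (aPlusBBPlusTAPlus (letter a) (letter b) (letter t)))
    (h₂ : V.Stable (betaClass (letter a * letter t * letter b ^ 2 * letter a))) :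
    ¬ V.FinitelyBased := by
  rintro ⟨S, hS, hbasis⟩
  obtain ⟨N, hN⟩ : ∃ N, ∀ e ∈ S, e.1.toList.toFinset.card + e.2.toList.toFinset.card ≤ N := by
    obtain ⟨N, hN⟩ := (hS.image fun e : Word × Word =>
      e.1.toList.toFinset.card + e.2.toList.toFinset.card).bddAbove
    exact ⟨N, fun e he => hN (Set.mem_image_of_mem _ he)⟩
  have hSV : ∀ e ∈ S, V.Satisfies e.1 e.2 := fun e he =>
    (hbasis _ _).2 fun M _ hM => hM e he
  -- Taking `n = N + 2` exceeds the letter count of every basis identity and ensures `n ≥ 2`, which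
  -- `wordV` needs to violate the invariant.
  have step : ∀ u v : Word, V.Satisfies u v → u.toList.toFinset.card < N + 2 →
      ∀ (φ : Word →* Word) (A B : Word),
      (V.Satisfies (wordU (N + 2)) (A * φ u * B) ∧ GapFree (N + 2) (A * φ u * B).toList) →
      (V.Satisfies (wordU (N + 2)) (A * φ v * B) ∧ GapFree (N + 2) (A * φ v * B).toList) := by
    rintro u v huv hu φ A B ⟨hU, hP⟩
    refine ⟨hU.trans (((huv.map φ).mul_left A).mul_right B), ?_⟩
    have hO := MonoidVariety.blockOrdered_of_satisfies hab hat hbt h₁ hU (blockOrdered_wordU _)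
    exact MonoidVariety.gapFree_of_satisfies hab hat hbt h₁ h₂ huv hu φ hO hP
  have key := mem_iff_mem_of_ofIdentities
    (L := {w | V.Satisfies (wordU (N + 2)) w ∧ GapFree (N + 2) w.toList})
    (fun e he φ A B => by
      have := hN e he
      exact ⟨step _ _ (hSV e he) (by omega) φ A B,
        step _ _ (hSV e he).symm (by omega) φ A B⟩)
    ((hbasis _ _).1 (hV (N + 2) (by omega)))
  exact not_gapFree_wordV (by omega)
    (key.1 ⟨V.congruence.refl _, gapFree_wordU (by omega)⟩).2
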